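/- Let $\mathfrak M$ be a von Neumann algebra on a complex Hilbert space $\mathcal H$, with identity $\mathbb I$, and let $1\le p<\infty$. Let $\mathfrak F=\{\varphi_\alpha\}_{\alpha\in\mathcal I}$ be a family of normal finite traces on $\mathfrak M$, that is, normal positive linear functionals with $\varphi_\alpha(XY)=\varphi_\alpha(YX)$ for all $X,Y\in\mathfrak M$. Assume that $\mathfrak F$ is sufficient (if $X\in\mathfrak M$, $X\ge 0$ and $\varphi_\alpha(X)=0$ for every $\alpha\in\mathcal I$, then $X=0$) and that $\varphi_\alpha(\mathbb I)\le 1$ for every $\alpha\in\mathcal I$. Then $$\|X\|_{p,\mathcal I}=\sup_{\alpha\in\mathcal I}\varphi_\alpha(|X|^p)^{1/p}\qquad(X\in\mathfrak M)$$ is a (finite) norm on $\mathfrak M$. Moreover, if $\mathfrak M(p,\mathcal I)$ denotes the Banach space completion of $\mathfrak M$ with respect to $\|\cdot\|_{p,\mathcal I}$, then $\mathfrak M(p,\mathcal I)$ carries module operations and an involution, extending those of $\mathfrak M\subset\mathfrak M(p,\mathcal I)$, with which $(\mathfrak M(p,\mathcal I)[\|\cdot\|_{p,\mathcal I}],\ \mathfrak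 M[\|\cdot\|_{\mathcal B(\mathcal H)}])$ is a CQ*-algebra. Here a quasi *-algebra $(\mathfrak X,\mathfrak A_0)$ consists of a complex vector space $\mathfrak X$ with involution and a *-algebra $\mathfrak A_0\subset\mathfrak X$ such that $\mathfrak X$ is an $\mathfrak A_0$-bimodule whose module operations and involution extend those of $\mathfrak A_0$, with $(ax)^*=x^*a^*$ and $(xa)^*=a^*x^*$ for $a\in\mathfrak A_0$, $x\in\mathfrak X$. It is a Banach quasi *-algebra if $\mathfrak X$ is a Banach space with norm $\|\cdot\|$, the involution is isometric, the maps $x\mapsto ax$ and $x\mapsto xa$ are continuous on $\mathfrak X$ for every $a\in\mathfrak A_0$, and $\mathfrak A_0$ is dense in $\mathfrak X$. It is a CQ*-algebra if, in addition, $\mathfrak A_0$ has a second norm $\|\cdot\|_0$, making it a normed algebra, such that $\|a^*a\|_0=\|a\|_0^2$, $\|a\|\le\|a\|_0$ and $\|ax\|\le\|a\|_0\|x\|$ for all $a\in\mathfrak A_0$, $x\in\mathfrak X$, and $\mathfrak A_0[\|\cdot\|_0]$ is complete. -/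

import Mathlib

open scoped ComplexOrder

universe u v w

/-- A quasi *-algebra `(X, A)`: a complex vector space `X` containing the complex *-algebra `A`
(through the injective linear map `incl`), which is an `A`-bimodule and carries an involution, the
module operations and the involution of `X` extending those of `A`. -/
structure QuasiStarAlgebra (X : Type u) (A : Type v) [AddCommGroup X] [Module ℂ X]
    [NonUnitalRing A] [Module ℂ A] [StarRing A] where
  incl : A →ₗ[ℂ] X
  incl_injective : Function.Injective incl
  /-- left multiplication `a x` -/
  lmul : A →ₗ[ℂ] X →ₗ[ℂ] X
  /-- right multiplication: `rmul a x` is `x a` -/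
  rmul : A →ₗ[ℂ] X →ₗ[ℂ] X
  /-- the conjugate linear involution `x ↦ x*` -/
  invol : X →ₛₗ[starRingEnd ℂ] X
  lmul_lmul : ∀ a b x, lmul a (lmul b x) = lmul (a * b) x
  rmul_rmul : ∀ a b x, rmul b (rmul a x) = rmul (a * b) x
  lmul_rmul : ∀ a b x, lmul a (rmul b x) = rmul b (lmul a x)
  invol_invol : ∀ x, invol (invol x) = x
  invol_lmul : ∀ a x, invol (lmul a x) = rmul (star a) (invol x)
  invol_rmul : ∀ a x, invol (rmul a x) = lmul (star a) (invol x)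
  lmul_incl : ∀ a b, lmul a (incl b) = incl (a * b)
  rmul_incl : ∀ a b, rmul b (incl a) = incl (a * b)
  invol_incl : ∀ a, invol (incl a) = incl (star a)

namespace QuasiStarAlgebra

/-- `(X, A)` is a Banach quasi *-algebra for the norm of `X`. -/
structure IsBanach {X : Type u} {A : Type v} [NormedAddCommGroup X] [NormedSpace ℂ X]
    [NonUnitalRing A] [Module ℂ A] [StarRing A] (Q : QuasiStarAlgebra X A) : Prop where
  norm_invol : ∀ x, ‖Q.invol x‖ = ‖x‖
  continuous_lmul : ∀ a, Continuous (Q.lmul a)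
  continuous_rmul : ∀ a, Continuous (Q.rmul a)
  dense : DenseRange Q.incl
  complete : CompleteSpace X

/-- `(X, A)` is a CQ*-algebra, where the norm of `X` is `‖·‖` and the norm of `A` is the second
norm `‖·‖₀`. -/
structure IsCQStar {X : Type u} {A : Type v} [NormedAddCommGroup X] [NormedSpace ℂ X]
    [NonUnitalNormedRing A] [NormedSpace ℂ A] [StarRing A] (Q : QuasiStarAlgebra X A) : Prop
    extends Q.IsBanach where
  norm_star_mul_self : ∀ a : A, ‖star a * a‖ = ‖a‖ ^ 2
  norm_incl_le : ∀ a : A, ‖Q.incl a‖ ≤ ‖a‖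
  norm_lmul_le : ∀ (a : A) (x : X), ‖Q.lmul a x‖ ≤ ‖a‖ * ‖x‖
  complete_zero : CompleteSpace A

end QuasiStarAlgebra

namespace VonNeumannAlgebra

variable {H : Type u} [NormedAddCommGroup H] [InnerProductSpace ℂ H] [CompleteSpace H]

/-- The *-algebra of elements of `M`, with the operator norm. -/
abbrev Elem (M : VonNeumannAlgebra H) : Type u := ↥M.toStarSubalgebra

/-- The operator `|X|^p` (continuous functional calculus in `B(H)`) belongs to `M` if `X` does. -/
theorem abs_rpow_mem (M : VonNeumannAlgebra H) (p : ℝ) (X : M.Elem) :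
    (CFC.abs (X : H →L[ℂ] H)) ^ p ∈ M.toStarSubalgebra := by
  have hbi : ∀ T : H →L[ℂ] H,
      (∀ Y ∈ Set.centralizer (M : Set (H →L[ℂ] H)), Commute T Y) → T ∈ M.toStarSubalgebra := by
    intro T hT
    rw [mem_carrier, ← M.centralizer_centralizer]
    intro Y hY
    exact (hT Y hY).symm.eq
  refine hbi _ fun Y hY => ?_
  rw [CFC.rpow_def]
  apply Commute.cfc_nnreal
  have h1 : Commute (star (X : H →L[ℂ] H) * X) Y :=
    (hY _ (mul_mem (star_mem X.2) X.2) : _)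
  rw [CFC.abs, CFC.sqrt_eq_cfc]
  exact h1.cfc_nnreal _

/-- `|X|^p` as an element of `M`. -/
noncomputable def absRpow (M : VonNeumannAlgebra H) (p : ℝ) (X : M.Elem) : M.Elem :=
  ⟨(CFC.abs (X : H →L[ℂ] H)) ^ p, M.abs_rpow_mem p X⟩

/-- A normal finite trace on `M`: a positive linear functional `φ` on `M` with
`φ (X Y) = φ (Y X)`, which respects suprema of increasing (i.e. upward directed) families of
positive elements of `M`. -/
structure NormalFiniteTrace (M : VonNeumannAlgebra H) where
  toLinearMap : M.Elem →ₗ[ℂ] ℂ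
  nonneg : ∀ X : M.Elem, 0 ≤ (X : H →L[ℂ] H) → 0 ≤ toLinearMap X
  map_mul_comm : ∀ X Y : M.Elem, toLinearMap (X * Y) = toLinearMap (Y * X)
  normal : ∀ (S : Set M.Elem) (X : M.Elem), S.Nonempty →
    (∀ Y ∈ S, 0 ≤ (Y : H →L[ℂ] H)) →
    DirectedOn (fun Y Z : M.Elem => (Y : H →L[ℂ] H) ≤ (Z : H →L[ℂ] H)) S →
    IsLUB ((fun Y : M.Elem => (Y : H →L[ℂ] H)) '' S) (X : H →L[ℂ] H) →
    IsLUB ((fun Y => (toLinearMap Y).re) '' S) (toLinearMap X).re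

variable {M : VonNeumannAlgebra H}

/-- A family of traces is sufficient if it separates the positive elements from `0`. -/
def IsSufficient {I : Type v} (φ : I → M.NormalFiniteTrace) : Prop :=
  ∀ X : M.Elem, 0 ≤ (X : H →L[ℂ] H) → (∀ α, (φ α).toLinearMap X = 0) → X = 0

/-- `‖X‖_{p,φ} = φ(|X|^p)^{1/p}`. -/
noncomputable def NormalFiniteTrace.pNorm (φ : M.NormalFiniteTrace) (p : ℝ) (X : M.Elem) : ℝ :=
  (φ.toLinearMap (M.absRpow p X)).re ^ (1 / p)

/-- `‖X‖_{p,I} = sup_α ‖X‖_{p,φ_α}`. -/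
noncomputable def supPNorm {I : Type v} (φ : I → M.NormalFiniteTrace) (p : ℝ) (X : M.Elem) : ℝ :=
  ⨆ α, (φ α).pNorm p X

/-- `‖·‖_{p,I}` is a norm on the complex vector space `M`: it is finite, i.e. the supremum is that
of a bounded family for every `X`, and satisfies the axioms of a norm. -/
structure SupPNormIsNorm {I : Type v} (φ : I → M.NormalFiniteTrace) (p : ℝ) : Prop where
  bddAbove : ∀ X : M.Elem, BddAbove (Set.range fun α => (φ α).pNorm p X)
  nonneg : ∀ X : M.Elem, 0 ≤ supPNorm φ p X
  smul : ∀ (c : ℂ) (X : M.Elem), supPNorm φ p (c • X) = ‖c‖ * supPNorm φ p X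
  add_le : ∀ X Y : M.Elem, supPNorm φ p (X + Y) ≤ supPNorm φ p X + supPNorm φ p Y
  eq_zero_iff : ∀ X : M.Elem, supPNorm φ p X = 0 ↔ X = 0

/-- The normed space `M[‖·‖_{p,I}]`, formed from the proof `h` that `‖·‖_{p,I}` is a norm. -/
def WithPNorm {I : Type v} {φ : I → M.NormalFiniteTrace} {p : ℝ} (_h : SupPNormIsNorm φ p) :
    Type u := M.Elem

namespace WithPNorm

variable {I : Type v} {φ : I → M.NormalFiniteTrace} {p : ℝ}

noncomputable instance instAddCommGroup (h : SupPNormIsNorm φ p) : AddCommGroup (WithPNorm h) :=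
  inferInstanceAs (AddCommGroup M.Elem)

noncomputable instance instModule (h : SupPNormIsNorm φ p) : Module ℂ (WithPNorm h) :=
  inferInstanceAs (Module ℂ M.Elem)

/-- The identity map from `M` to `M[‖·‖_{p,I}]`. -/
noncomputable def ofElem (h : SupPNormIsNorm φ p) : M.Elem ≃ₗ[ℂ] WithPNorm h :=
  LinearEquiv.refl ℂ M.Elem

noncomputable instance instNorm (h : SupPNormIsNorm φ p) : Norm (WithPNorm h) :=
  ⟨fun X => supPNorm φ p ((ofElem h).symm X)⟩

theorem core (h : SupPNormIsNorm φ p) : NormedSpace.Core ℂ (WithPNorm h) where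
  norm_nonneg X := h.nonneg ((ofElem h).symm X)
  norm_smul c X := h.smul c ((ofElem h).symm X)
  norm_triangle X Y := h.add_le ((ofElem h).symm X) ((ofElem h).symm Y)
  norm_eq_zero_iff X := h.eq_zero_iff ((ofElem h).symm X)

noncomputable instance instNormedAddCommGroup (h : SupPNormIsNorm φ p) :
    NormedAddCommGroup (WithPNorm h) :=
  NormedAddCommGroup.ofCore (core h)

noncomputable instance instNormedSpace (h : SupPNormIsNorm φ p) : NormedSpace ℂ (WithPNorm h) :=
  NormedSpace.ofCore (core h)

/-- The Banach space completion `M(p, I)` of `M` with respect to `‖·‖_{p,I}`. -/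
abbrev Completion (h : SupPNormIsNorm φ p) : Type u :=
  UniformSpace.Completion (WithPNorm h)

/-- The canonical map of `M` into its completion. -/
noncomputable def toCompletion (h : SupPNormIsNorm φ p) (X : M.Elem) : Completion h :=
  (ofElem h X : UniformSpace.Completion (WithPNorm h))

end WithPNorm

end VonNeumannAlgebra

/-!
The mathematical content is that `X ↦ φ(|X|^p)^(1/p)` is, for a trace `φ`, a seminorm satisfying
`‖A X‖_p ≤ ‖A‖ ‖X‖_p`, `‖X*‖_p = ‖X‖_p` and `‖X‖_p ≤ ‖X‖`. This holds for every positive tracial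
functional `τ` on a unital C*-algebra, and is proved there, without polar decompositions, spectral
projections or normality.

* For positive `S` and `R`, the functional `∑ fᵢ ⊗ gᵢ ↦ ∑ τ(fᵢ(S) gᵢ(R))` is positive on functions
  of two variables (`PositiveLinearMap.IsTracial.sum_cfc_mul_cfc_nonneg`): a Bernstein approximation
  in the second variable reduces this to `τ(f(S) h(R)) ≥ 0` for `f, h ≥ 0`. Applied to the scalar
  Young inequality it gives `p τ(R^(p-1) S) ≤ (p - 1) τ(R^p) + τ(S^p)`, and from that the
  monotonicity of `S ↦ τ(S^p)`, hence the bounds on `‖A X‖_p` and `‖X‖_p`.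
* `τ(f(X* X)) = τ(f(X X*))` if `f(0) = 0`, which gives `‖X*‖_p = ‖X‖_p`.
* Cauchy–Schwarz extends Young's inequality to `Re τ(R^(p-1) U* X)` with `U` a contraction and `X`
  arbitrary (`PositiveLinearMap.IsTracial.young`). As `τ(|X|^p)` is approximately
  `τ(|X|^(p-1) U* X)` for a suitable `U`, the function `X ↦ τ(|X|^p)` is a supremum of affine
  functions up to arbitrarily small errors, so it is convex; Minkowski's inequality follows by
  homogeneity.

Taking suprema over the family of traces preserves all these properties, and sufficiency makes the
supremum definite. The module operations and the involution then extend to the completion by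
continuity (`QuasiStarAlgebra.ofDenseRange`).
-/

/-! ### Positive tracial functionals -/

namespace PositiveLinearMap

open Filter Topology

variable {A : Type*} [CStarAlgebra A] [PartialOrder A]

/-- A positive functional is tracial if its value on a product of two elements does not depend on
their order. -/
def IsTracial (τ : A →ₚ[ℂ] ℂ) : Prop := ∀ a b, τ (a * b) = τ (b * a)

lemma re_mono (τ : A →ₚ[ℂ] ℂ) {a b : A} (h : a ≤ b) : (τ a).re ≤ (τ b).re :=
  (Complex.le_def.1 (OrderHomClass.mono τ h)).1

lemma re_smul (τ : A →ₚ[ℂ] ℂ) (r : ℝ) (a : A) : (τ (r • a)).re = r * (τ a).re := by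
  rw [map_smul_of_tower, Complex.real_smul, Complex.re_ofReal_mul]

lemma re_nonneg (τ : A →ₚ[ℂ] ℂ) {a : A} (h : 0 ≤ a) : 0 ≤ (τ a).re := by
  simpa using τ.re_mono h

variable [StarOrderedRing A]

lemma IsTracial.re_mul_nonneg {τ : A →ₚ[ℂ] ℂ} (hτ : τ.IsTracial) {a b : A} (ha : 0 ≤ a)
    (hb : 0 ≤ b) : 0 ≤ (τ (a * b)).re := by
  have h : τ (a * b) = τ (CFC.sqrt a * b * CFC.sqrt a) := by
    rw [hτ (CFC.sqrt a * b), ← mul_assoc, CFC.sqrt_mul_sqrt_self a]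
  rw [h]
  refine τ.re_nonneg ?_
  have := star_left_conjugate_nonneg hb (CFC.sqrt a)
  rwa [(IsSelfAdjoint.of_nonneg (CFC.sqrt_nonneg a)).star_eq] at this

open unitInterval in
/-- A positive tracial functional induces a functional `∑ fᵢ ⊗ gᵢ ↦ ∑ τ (fᵢ(S) gᵢ(R))` on the
functions of two variables, and this functional is positive. Replacing the `gᵢ` by their Bernstein
approximations reduces this to the positivity of `τ (f(S) h(R))` for `f, h ≥ 0`. -/
lemma IsTracial.sum_cfc_mul_cfc_nonneg {τ : A →ₚ[ℂ] ℂ} (hτ : τ.IsTracial) {ι : Type*} [Fintype ι]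
    {S R : A} (hS : 0 ≤ S) (hR : 0 ≤ R) (f g : ι → ℝ → ℝ)
    (hf : ∀ i, Continuous (f i)) (hg : ∀ i, Continuous (g i))
    (hfg : ∀ s r, 0 ≤ s → 0 ≤ r → 0 ≤ ∑ i, f i s * g i r) :
    0 ≤ (τ (∑ i, cfc (f i) S * cfc (g i) R)).re := by
  have hSa : IsSelfAdjoint S := .of_nonneg hS
  have hRa : IsSelfAdjoint R := .of_nonneg hR
  set c : ℝ := ‖R‖ + 1
  have hc : 0 < c := by positivity
  have hspec : ∀ r ∈ spectrum ℝ R, r / c ∈ I := fun r hr =>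
    ⟨div_nonneg (spectrum_nonneg_of_nonneg hR hr) hc.le, by
      rw [div_le_one hc]
      have := (le_algebraMap_iff_spectrum_le (a := R)).1 hRa.le_algebraMap_norm_self r hr
      linarith⟩
  let G : ι → C(I, ℝ) := fun i => ⟨fun x => g i (c * x), by have := hg i; fun_prop⟩
  -- the Bernstein approximations of `g i`, rescaled to an interval containing the spectrum
  let e : (n : ℕ) → Fin (n + 1) → ℝ → ℝ := fun n k r =>
    bernstein n k (Set.projIcc 0 1 zero_le_one (r / c))
  have he : ∀ n k, Continuous (e n k) := fun n k =>
    (bernstein n k).continuous.comp (continuous_projIcc.comp (by fun_prop))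
  let y : (n : ℕ) → Fin (n + 1) → ℝ := fun n k => c * (bernstein.z k : I)
  have hlim : ∀ i, Tendsto (fun n => cfc (fun r => ∑ k, g i (y n k) * e n k r) R) atTop
      (𝓝 (cfc (g i) R)) := by
    intro i
    refine tendsto_cfc_fun ?_ (.of_forall fun n => ?_)
    · have h := ContinuousMap.tendsto_iff_tendstoUniformly.1 (bernsteinApproximation_uniform (G i))
      rw [Metric.tendstoUniformly_iff] at h
      rw [Metric.tendstoUniformlyOn_iff]
      intro ε hε
      filter_upwards [h ε hε] with n hn r hr
      have h1 := hn (Set.projIcc 0 1 zero_le_one (r / c))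
      have h2 : (Set.projIcc 0 1 zero_le_one (r / c) : ℝ) = r / c := by
        rw [Set.projIcc_of_mem zero_le_one (hspec r hr)]
      rw [bernsteinApproximation.apply] at h1
      simp only [G, ContinuousMap.coe_mk, h2, mul_div_cancel₀ r hc.ne', smul_eq_mul] at h1
      simpa [e, y, mul_comm] using h1
    · exact (continuous_finsetSum _ fun k _ => (he n k).const_mul _).continuousOn
  have hlim' : Tendsto (fun n => (τ (∑ i, cfc (f i) S *
      cfc (fun r => ∑ k, g i (y n k) * e n k r) R)).re) atTop
      (𝓝 (τ (∑ i, cfc (f i) S * cfc (g i) R)).re) := by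
    refine (Complex.continuous_re.tendsto _).comp (((map_continuous τ).tendsto _).comp ?_)
    exact tendsto_finsetSum _ fun i _ => (hlim i).const_mul _
  refine ge_of_tendsto' hlim' fun n => ?_
  have h1 : ∑ i, cfc (f i) S * cfc (fun r => ∑ k, g i (y n k) * e n k r) R =
      ∑ k, cfc (fun s => ∑ i, f i s * g i (y n k)) S * cfc (e n k) R := by
    have h2 : ∀ i, cfc (fun r => ∑ k, g i (y n k) * e n k r) R =
        ∑ k, g i (y n k) • cfc (e n k) R := by
      intro i
      have h3 := cfc_sum_univ (fun k r => g i (y n k) * e n k r) R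
        (fun k => ((he n k).const_mul _).continuousOn)
      have h4 : (fun r => ∑ k, g i (y n k) * e n k r) =
          ∑ k, (fun k r => g i (y n k) * e n k r) k := by
        ext r; simp
      rw [h4, h3]
      refine Finset.sum_congr rfl fun k _ => ?_
      exact cfc_const_mul _ (e n k) R (he n k).continuousOn
    have h5 : ∀ k, cfc (fun s => ∑ i, f i s * g i (y n k)) S =
        ∑ i, g i (y n k) • cfc (f i) S := by
      intro k
      have h3 := cfc_sum_univ (fun i s => g i (y n k) * f i s) S
        (fun i => ((hf i).const_mul _).continuousOn)
      have h4 : (fun s => ∑ i, f i s * g i (y n k)) =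
          ∑ i, (fun i s => g i (y n k) * f i s) i := by
        ext r; simp [mul_comm]
      rw [h4, h3]
      refine Finset.sum_congr rfl fun i _ => ?_
      exact cfc_const_mul _ (f i) S (hf i).continuousOn
    simp only [h2, h5, Finset.mul_sum, Finset.sum_mul]
    rw [Finset.sum_comm]
    simp
  rw [h1, map_sum, Complex.re_sum]
  refine Finset.sum_nonneg fun k _ => hτ.re_mul_nonneg ?_ ?_
  · refine cfc_nonneg fun s hs => hfg s _ (spectrum_nonneg_of_nonneg hS hs) ?_
    exact mul_nonneg hc.le (bernstein.z k).2.1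
  · exact cfc_nonneg fun r _ => bernstein_nonneg

/-- Young's inequality for a pair of positive elements. -/
lemma IsTracial.young_of_nonneg {τ : A →ₚ[ℂ] ℂ} (hτ : τ.IsTracial) {p : ℝ} (hp : 1 ≤ p) {R S : A}
    (hR : 0 ≤ R) (hS : 0 ≤ S) :
    p * (τ (R ^ (p - 1) * S)).re ≤ (p - 1) * (τ (R ^ p)).re + (τ (S ^ p)).re := by
  have hSa : IsSelfAdjoint S := .of_nonneg hS
  have hRa : IsSelfAdjoint R := .of_nonneg hR
  have hp0 : 0 < p := by linarith
  have hc1 : Continuous fun x : ℝ => x ^ (p - 1) := Real.continuous_rpow_const (by linarith)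
  have hc2 : Continuous fun x : ℝ => x ^ p := Real.continuous_rpow_const hp0.le
  have h := hτ.sum_cfc_mul_cfc_nonneg hS hR
    ![fun _ => 1, fun s => s ^ p, fun s => s]
    ![fun r => (p - 1) * r ^ p, fun _ => 1, fun r => -p * r ^ (p - 1)]
    (by intro i; fin_cases i <;> simp <;> fun_prop)
    (by intro i; fin_cases i <;> simp <;> fun_prop) (by
      intro s r hs hr
      simp only [Fin.sum_univ_three, Matrix.cons_val]
      have h := Real.geom_mean_le_arith_mean2_weighted (w₁ := (p - 1) / p) (w₂ := 1 / p)
        (div_nonneg (by linarith) hp0.le) (by positivity) (Real.rpow_nonneg hr p)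
        (Real.rpow_nonneg hs p) (by field_simp; ring)
      rw [← Real.rpow_mul hr, ← Real.rpow_mul hs, mul_div_cancel₀ _ hp0.ne',
        mul_one_div_cancel hp0.ne', Real.rpow_one] at h
      have h' := mul_le_mul_of_nonneg_left h hp0.le
      have h2 : p * ((p - 1) / p * r ^ p + 1 / p * s ^ p) = (p - 1) * r ^ p + s ^ p := by
        field_simp
      rw [h2] at h'
      nlinarith)
  simp only [Fin.sum_univ_three, Matrix.cons_val] at h
  rw [cfc_const_one ℝ S, cfc_const_one ℝ R, cfc_id' ℝ S,
    cfc_const_mul _ _ R hc2.continuousOn, cfc_const_mul _ _ R hc1.continuousOn,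
    ← CFC.rpow_eq_cfc_real hS, ← CFC.rpow_eq_cfc_real hR, ← CFC.rpow_eq_cfc_real hR, one_mul,
    mul_one, mul_smul_comm, map_add, map_add, Complex.add_re, Complex.add_re, re_smul, re_smul,
    hτ S] at h
  linarith

lemma _root_.CFC.rpow_mul_rpow_of_nonneg {a : A} (ha : 0 ≤ a) {x y : ℝ} (hx : 0 ≤ x) (hy : 0 ≤ y) :
    a ^ x * a ^ y = a ^ (x + y) := by
  rw [CFC.rpow_eq_cfc_real ha, CFC.rpow_eq_cfc_real ha, CFC.rpow_eq_cfc_real ha,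
    ← cfc_mul _ _ a (Real.continuous_rpow_const hx).continuousOn
      (Real.continuous_rpow_const hy).continuousOn]
  exact cfc_congr fun r hr =>
    (Real.rpow_add_of_nonneg (spectrum_nonneg_of_nonneg ha hr) hx hy).symm

lemma _root_.CFC.rpow_sub_one_mul_self {a : A} (ha : 0 ≤ a) {x : ℝ} (hx : 1 ≤ x) :
    a ^ (x - 1) * a = a ^ x := by
  have h := CFC.rpow_mul_rpow_of_nonneg ha (sub_nonneg.2 hx) zero_le_one
  rwa [CFC.rpow_one a ha, sub_add_cancel] at h

/-- Monotonicity of `a ↦ τ (a ^ p)`, although `a ↦ a ^ p` is not monotone for `p > 1`. -/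
lemma IsTracial.re_rpow_mono {τ : A →ₚ[ℂ] ℂ} (hτ : τ.IsTracial) {p : ℝ} (hp : 1 ≤ p) {S T : A}
    (hS : 0 ≤ S) (hST : S ≤ T) : (τ (S ^ p)).re ≤ (τ (T ^ p)).re := by
  have h1 := hτ.young_of_nonneg hp hS (hS.trans hST)
  have h2 : (τ (S ^ (p - 1) * S)).re ≤ (τ (S ^ (p - 1) * T)).re := by
    have := hτ.re_mul_nonneg (CFC.rpow_nonneg (a := S) (y := p - 1)) (sub_nonneg.2 hST)
    rw [mul_sub, map_sub, Complex.sub_re] at this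
    linarith
  rw [CFC.rpow_sub_one_mul_self hS hp] at h2
  nlinarith

end PositiveLinearMap

/-! ### Trace identities and approximate polar decompositions -/

namespace PositiveLinearMap

open Filter Topology

variable {A : Type*} [CStarAlgebra A]

lemma _root_.CFC.add_smul_one_eq_cfc {a : A} (ha : IsSelfAdjoint a) (r : ℝ) :
    a + r • (1 : A) = cfc (fun x : ℝ => x + r) a := by
  rw [cfc_add_const r (fun x : ℝ => x) a (by fun_prop) ha, cfc_id' ℝ a ha,
    Algebra.algebraMap_eq_smul_one]

variable [PartialOrder A] [StarOrderedRing A]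

open Polynomial in
/-- A trace does not distinguish `f(a* a)` from `f(a a*)`, if `f` vanishes at `0`. For monomials
this is the trace property, and the general case follows by uniform approximation. -/
lemma IsTracial.cfc_star_mul_self {τ : A →ₚ[ℂ] ℂ} (hτ : τ.IsTracial) {f : ℝ → ℝ}
    (hf : Continuous f) (hf0 : f 0 = 0) (a : A) :
    τ (cfc f (star a * a)) = τ (cfc f (a * star a)) := by
  set c : ℝ := ‖a‖ ^ 2
  have hs1 : spectrum ℝ (star a * a) ⊆ Set.Icc 0 c := fun x hx =>
    ⟨spectrum_nonneg_of_nonneg (star_mul_self_nonneg a) hx,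
      (le_algebraMap_iff_spectrum_le (a := star a * a)).1
        CStarAlgebra.star_mul_le_algebraMap_norm_sq x hx⟩
  have hs2 : spectrum ℝ (a * star a) ⊆ Set.Icc 0 c := fun x hx =>
    ⟨spectrum_nonneg_of_nonneg (mul_star_self_nonneg a) hx,
      (le_algebraMap_iff_spectrum_le (a := a * star a)).1
        CStarAlgebra.mul_star_le_algebraMap_norm_sq x hx⟩
  -- polynomials without constant term
  have hpoly : ∀ q : ℝ[X], τ (aeval (star a * a) (X * q)) = τ (aeval (a * star a) (X * q)) := by
    intro q
    have hsemi : a * aeval (star a * a) q = aeval (a * star a) q * a := by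
      induction q using Polynomial.induction_on' with
      | add p q hp hq => simp only [map_add, mul_add, add_mul, hp, hq]
      | monomial n r =>
        simp only [aeval_monomial, Algebra.algebraMap_eq_smul_one, smul_mul_assoc, one_mul,
          mul_smul_comm, mul_pow_mul]
    simp only [map_mul, aeval_X]
    rw [mul_assoc, hsemi, hτ, mul_assoc, hτ]
  have happrox : ∀ n : ℕ, ∃ q : ℝ[X], ∀ x ∈ Set.Icc 0 c, |(X * q).eval x - f x| < 1 / (n + 1) := by
    intro n
    have hn : (0 : ℝ) < 1 / (n + 1) / 2 := by positivity
    obtain ⟨P, hP⟩ := exists_polynomial_near_of_continuousOn 0 c f hf.continuousOn _ hn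
    refine ⟨P.divX, fun x hx => ?_⟩
    have h1 : (X * P.divX).eval x = P.eval x - P.eval 0 := by
      have := congrArg (eval x) P.divX_mul_X_add
      simp only [eval_add, eval_mul, eval_X, eval_C, coeff_zero_eq_eval_zero] at this
      rw [eval_mul, eval_X]
      linarith
    have h2 := hP x hx
    have h3 := hP 0 ⟨le_rfl, by positivity⟩
    rw [hf0, sub_zero] at h3
    rw [abs_lt] at h2 h3
    rw [h1, abs_lt]
    constructor <;> linarith
  choose q hq using happrox
  have hlim : ∀ b : A, IsSelfAdjoint b → spectrum ℝ b ⊆ Set.Icc 0 c →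
      Tendsto (fun n => τ (aeval b (X * q n))) atTop (𝓝 (τ (cfc f b))) := by
    intro b hb hspec
    refine ((map_continuous τ).tendsto _).comp ?_
    have h : ∀ n, aeval b (X * q n) = cfc (X * q n).eval b := fun n =>
      (cfc_polynomial (X * q n) b).symm
    simp only [h]
    refine tendsto_cfc_fun ?_ (.of_forall fun n => (X * q n).continuous.continuousOn)
    rw [Metric.tendstoUniformlyOn_iff]
    intro ε hε
    obtain ⟨N, hN⟩ := exists_nat_one_div_lt hε
    filter_upwards [eventually_ge_atTop N] with n hn x hx
    rw [dist_comm, Real.dist_eq]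
    refine (hq n x (hspec hx)).trans_le (le_trans ?_ hN.le)
    gcongr
  refine tendsto_nhds_unique (hlim _ (.star_mul_self a) hs1) ?_
  simp only [hpoly]
  exact hlim _ (.mul_star_self a) hs2

lemma _root_.CFC.abs_rpow_eq_cfc {p : ℝ} (hp : 0 ≤ p) (a : A) :
    CFC.abs a ^ p = cfc (fun x : ℝ => x ^ (p / 2)) (star a * a) := by
  rw [CFC.abs, CFC.sqrt_eq_rpow, CFC.rpow_rpow_of_exponent_nonneg _ _ _ (by norm_num) hp
    (star_mul_self_nonneg a), CFC.rpow_eq_cfc_real (star_mul_self_nonneg a),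
    one_div_mul_eq_div]

lemma IsTracial.abs_star_rpow {τ : A →ₚ[ℂ] ℂ} (hτ : τ.IsTracial) {p : ℝ} (hp : 1 ≤ p) (a : A) :
    τ (CFC.abs (star a) ^ p) = τ (CFC.abs a ^ p) := by
  rw [CFC.abs_rpow_eq_cfc (by linarith), CFC.abs_rpow_eq_cfc (by linarith), star_star]
  exact (hτ.cfc_star_mul_self (Real.continuous_rpow_const (by linarith))
    (Real.zero_rpow (by linarith)) a).symm

lemma IsTracial.mul_star_self_rpow {τ : A →ₚ[ℂ] ℂ} (hτ : τ.IsTracial) {p : ℝ} (hp : 1 ≤ p)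
    (a : A) : τ ((a * star a) ^ p) = τ ((star a * a) ^ p) := by
  rw [CFC.rpow_eq_cfc_real (mul_star_self_nonneg a), CFC.rpow_eq_cfc_real (star_mul_self_nonneg a)]
  exact (hτ.cfc_star_mul_self (Real.continuous_rpow_const (by linarith))
    (Real.zero_rpow (by linarith)) a).symm

/-- Cauchy–Schwarz, in additive form. -/
lemma two_mul_re_mul_le (τ : A →ₚ[ℂ] ℂ) (a b : A) :
    2 * (τ (a * b)).re ≤ (τ (a * star a)).re + (τ (star b * b)).re := by
  have h := τ.re_nonneg (star_mul_self_nonneg (star a - b))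
  have h1 : (τ (star b * star a)).re = (τ (a * b)).re := by
    rw [← star_mul, map_star]; simp
  simp only [star_sub, star_star, sub_mul, mul_sub, map_sub, Complex.sub_re, h1] at h
  linarith

lemma _root_.CFC.smul_rpow {a : A} (ha : 0 ≤ a) {c p : ℝ} (hc : 0 ≤ c) (hp : 0 ≤ p) :
    (c • a) ^ p = c ^ p • a ^ p := by
  have hca : 0 ≤ c • a := smul_nonneg hc ha
  rw [CFC.rpow_eq_cfc_real hca, CFC.rpow_eq_cfc_real ha,
    ← cfc_comp_smul c (fun x : ℝ => x ^ p) a (Real.continuous_rpow_const hp).continuousOn,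
    ← cfc_smul _ _ a (Real.continuous_rpow_const hp).continuousOn]
  exact cfc_congr fun x hx => Real.mul_rpow hc (spectrum_nonneg_of_nonneg ha hx)

lemma re_abs_smul_rpow (τ : A →ₚ[ℂ] ℂ) {p : ℝ} (hp : 0 ≤ p) (c : ℂ) (a : A) :
    (τ (CFC.abs (c • a) ^ p)).re = ‖c‖ ^ p * (τ (CFC.abs a ^ p)).re := by
  rw [CFC.abs_smul, CFC.smul_rpow (CFC.abs_nonneg a) (norm_nonneg c) hp, re_smul]

lemma IsTracial.re_abs_rpow_le_norm {τ : A →ₚ[ℂ] ℂ} (hτ : τ.IsTracial) {p : ℝ} (hp : 1 ≤ p)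
    (a : A) : (τ (CFC.abs a ^ p)).re ≤ ‖a‖ ^ p * (τ 1).re := by
  have h : CFC.abs a ≤ ‖a‖ • (1 : A) := by
    have := (IsSelfAdjoint.of_nonneg (CFC.abs_nonneg a)).le_algebraMap_norm_self
    rwa [CFC.norm_abs, Algebra.algebraMap_eq_smul_one] at this
  have h2 := hτ.re_rpow_mono hp (CFC.abs_nonneg a) h
  rwa [CFC.smul_rpow zero_le_one (norm_nonneg a) (by linarith), CFC.one_rpow, re_smul] at h2

lemma _root_.CFC.abs_mul_le (a b : A) : CFC.abs (a * b) ≤ ‖a‖ • CFC.abs b := by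
  have h1 : ‖a‖ • CFC.abs b = CFC.abs ((‖a‖ : ℂ) • b) := by
    rw [CFC.abs_smul]; simp
  rw [h1, CFC.abs, CFC.abs]
  refine CFC.sqrt_le_sqrt _ _ ?_
  have h2 := star_left_conjugate_le_conjugate
    (CStarAlgebra.star_mul_le_algebraMap_norm_sq (a := a)) b
  rw [star_mul, star_smul, smul_mul_smul_comm]
  convert h2 using 1
  · simp only [mul_assoc]
  · rw [Algebra.algebraMap_eq_smul_one, mul_smul_comm, smul_mul_assoc, mul_one, sq,
      ← Complex.coe_smul]
    simp

lemma IsTracial.re_abs_mul_rpow_le {τ : A →ₚ[ℂ] ℂ} (hτ : τ.IsTracial) {p : ℝ} (hp : 1 ≤ p)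
    (a b : A) : (τ (CFC.abs (a * b) ^ p)).re ≤ ‖a‖ ^ p * (τ (CFC.abs b ^ p)).re := by
  have h2 := hτ.re_rpow_mono hp (CFC.abs_nonneg _) (CFC.abs_mul_le a b)
  rwa [CFC.smul_rpow (CFC.abs_nonneg b) (norm_nonneg a) (by linarith), re_smul] at h2

/-- A substitute for the polar decomposition: up to an error `ε`, `|a|` is at most the
product of `a` with the adjoint of a contraction `u`, namely of `u = a (|a| + ε)⁻¹`. -/
lemma _root_.CFC.exists_abs_sub_le_star_mul (a : A) {ε : ℝ} (hε : 0 < ε) :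
    ∃ u : A, ‖u‖ ≤ 1 ∧ CFC.abs a - ε • (1 : A) ≤ star u * a := by
  have ha : 0 ≤ CFC.abs a := CFC.abs_nonneg a
  have hk : Continuous fun x : ℝ => (|x| + ε)⁻¹ :=
    Continuous.inv₀ (by fun_prop) fun x => by positivity
  have hsa : IsSelfAdjoint (cfc (fun x : ℝ => (|x| + ε)⁻¹) (CFC.abs a)) := cfc_predicate _ _
  have hsq : star a * a = cfc (fun x : ℝ => x ^ 2) (CFC.abs a) := by
    rw [← CFC.abs_sq, cfc_pow_id (CFC.abs a) 2]
  refine ⟨a * cfc (fun x : ℝ => (|x| + ε)⁻¹) (CFC.abs a), ?_, ?_⟩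
  · rw [← sq_le_one_iff₀ (norm_nonneg _), sq, ← CStarRing.norm_star_mul_self, star_mul, hsa.star_eq,
      mul_assoc, ← mul_assoc (star a), hsq, ← cfc_mul _ _ _ (by fun_prop) hk.continuousOn,
      ← cfc_mul _ _ _ hk.continuousOn (by fun_prop)]
    refine norm_cfc_le zero_le_one fun x _ => ?_
    rw [Real.norm_of_nonneg (by positivity), ← sq_abs x]
    have : |x| / (|x| + ε) ≤ 1 := (div_le_one (by positivity)).2 (by linarith)
    calc (|x| + ε)⁻¹ * (|x| ^ 2 * (|x| + ε)⁻¹) = (|x| / (|x| + ε)) ^ 2 := by ring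
      _ ≤ 1 := pow_le_one₀ (by positivity) this
  · rw [star_mul, hsa.star_eq, mul_assoc, hsq, ← cfc_mul _ _ _ hk.continuousOn (by fun_prop)]
    have h1 : CFC.abs a - ε • (1 : A) = cfc (fun x : ℝ => x - ε) (CFC.abs a) := by
      rw [sub_eq_add_neg, ← neg_smul, CFC.add_smul_one_eq_cfc (.of_nonneg ha)]
      rfl
    rw [h1, cfc_le_iff _ _ _ (by fun_prop) (by fun_prop)]
    intro x hx
    have hx0 : 0 ≤ x := spectrum_nonneg_of_nonneg ha hx
    rw [abs_of_nonneg hx0, inv_mul_eq_div, le_div_iff₀ (by positivity)]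
    nlinarith

/-- Approximately, `a` is a product of two square roots of its absolute value. -/
lemma _root_.CFC.exists_eq_mul_of_abs (a : A) {ε : ℝ} (hε : 0 < ε) :
    ∃ k l : A, a = k * l ∧ IsSelfAdjoint l ∧ star k * k ≤ CFC.abs a ∧
      l * l = CFC.abs a + ε • (1 : A) := by
  have ha : 0 ≤ CFC.abs a := CFC.abs_nonneg a
  have hs : Continuous fun x : ℝ => √(|x| + ε) := by fun_prop
  have hk : Continuous fun x : ℝ => (√(|x| + ε))⁻¹ := hs.inv₀ fun x => by positivity
  have hsa : IsSelfAdjoint (cfc (fun x : ℝ => (√(|x| + ε))⁻¹) (CFC.abs a)) := cfc_predicate _ _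
  have hsq : star a * a = cfc (fun x : ℝ => x ^ 2) (CFC.abs a) := by
    rw [← CFC.abs_sq, cfc_pow_id (CFC.abs a) 2]
  refine ⟨a * cfc (fun x : ℝ => (√(|x| + ε))⁻¹) (CFC.abs a), cfc (fun x : ℝ => √(|x| + ε))
    (CFC.abs a), ?_, cfc_predicate _ _, ?_, ?_⟩
  · rw [mul_assoc, ← cfc_mul _ _ _ hk.continuousOn hs.continuousOn]
    have : (fun x : ℝ => (√(|x| + ε))⁻¹ * √(|x| + ε)) = fun _ => 1 := by
      ext x
      exact inv_mul_cancel₀ (by positivity)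
    rw [this, cfc_const_one ℝ (CFC.abs a), mul_one]
  · rw [star_mul, hsa.star_eq, mul_assoc, ← mul_assoc (star a), hsq,
      ← cfc_mul _ _ _ (by fun_prop) hk.continuousOn,
      ← cfc_mul _ _ _ hk.continuousOn (by fun_prop)]
    conv_rhs => rw [← cfc_id' ℝ (CFC.abs a)]
    rw [cfc_le_iff _ _ _ (by fun_prop) (by fun_prop)]
    intro x hx
    have hx0 : 0 ≤ x := spectrum_nonneg_of_nonneg ha hx
    have h1 : (√(|x| + ε))⁻¹ * (x ^ 2 * (√(|x| + ε))⁻¹) = x ^ 2 / (x + ε) := by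
      rw [abs_of_nonneg hx0]
      have h2 : √(x + ε) * √(x + ε) = x + ε := Real.mul_self_sqrt (by positivity)
      calc _ = x ^ 2 / (√(x + ε) * √(x + ε)) := by ring
        _ = _ := by rw [h2]
    rw [h1, div_le_iff₀ (by positivity)]
    nlinarith
  · rw [← cfc_mul _ _ _ hs.continuousOn hs.continuousOn,
      CFC.add_smul_one_eq_cfc (.of_nonneg ha)]
    refine cfc_congr fun x hx => ?_
    have hx0 : 0 ≤ x := spectrum_nonneg_of_nonneg ha hx
    simp only [abs_of_nonneg hx0]
    exact Real.mul_self_sqrt (by positivity)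

/-- Convexity of the power function, applied to `b + ε = (1 - ε) b + ε (b + 1)`. -/
lemma _root_.CFC.add_smul_one_rpow_le {b : A} (hb : 0 ≤ b) {p : ℝ} (hp : 1 ≤ p) {ε : ℝ}
    (hε : 0 < ε) (hε1 : ε ≤ 1) :
    (b + ε • (1 : A)) ^ p ≤ b ^ p + ε • (b + 1) ^ p := by
  have h1 : ∀ δ : ℝ, 0 < δ → (b + δ • (1 : A)) ^ p = cfc (fun x : ℝ => (x + δ) ^ p) b := by
    intro δ hδ
    rw [CFC.add_smul_one_eq_cfc (.of_nonneg hb), CFC.cfc_rpow fun x hx =>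
      add_pos_of_nonneg_of_pos (spectrum_nonneg_of_nonneg hb hx) hδ]
  have hc : ∀ δ : ℝ, Continuous fun x : ℝ => (x + δ) ^ p := fun δ =>
    (Real.continuous_rpow_const (by linarith)).comp (by fun_prop)
  have hc' : Continuous fun x : ℝ => x ^ p := Real.continuous_rpow_const (by linarith)
  have h2 := h1 1 one_pos
  rw [one_smul] at h2
  rw [h1 ε hε, h2, CFC.rpow_eq_cfc_real hb, ← cfc_smul _ _ _ (hc 1).continuousOn,
    ← cfc_add b (fun x => x ^ p) (fun x => ε • (x + 1) ^ p) hc'.continuousOn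
      ((hc 1).const_smul ε).continuousOn,
    cfc_le_iff (fun x => (x + ε) ^ p) (fun x => x ^ p + ε • (x + 1) ^ p) b (hc ε).continuousOn
      (hc'.add ((hc 1).const_smul ε)).continuousOn (.of_nonneg hb)]
  intro x hx
  have hx0 : 0 ≤ x := spectrum_nonneg_of_nonneg hb hx
  have h3 := (convexOn_rpow hp).2 (x := x) (y := x + 1) hx0 (by simp; linarith)
    (sub_nonneg.2 hε1) hε.le (by ring)
  simp only [smul_eq_mul] at h3 ⊢
  have h4 : (1 - ε) * x + ε * (x + 1) = x + ε := by ring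
  rw [h4] at h3
  have h5 : 0 ≤ ε * x ^ p := by positivity
  linarith

end PositiveLinearMap

/-! ### Minkowski's inequality -/

namespace PositiveLinearMap

variable {A : Type*} [CStarAlgebra A] [PartialOrder A] [StarOrderedRing A]

/-- If `x ≤ y + ε c` for all small `ε > 0`, then `x ≤ y`. -/
lemma _root_.le_of_forall_pos_le_add_mul {x y c : ℝ}
    (h : ∀ ε : ℝ, 0 < ε → ε ≤ 1 → x ≤ y + ε * c) : x ≤ y := by
  refine le_of_forall_pos_le_add fun δ hδ => ?_
  have hc : 0 < |c| + 1 := by positivity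
  set ε := min 1 (δ / (|c| + 1))
  have hε : 0 < ε := lt_min one_pos (by positivity)
  have h1 := h ε hε (min_le_left _ _)
  have h2 : ε * (|c| + 1) ≤ δ := (le_div_iff₀ hc).1 (min_le_right _ _)
  have h3 : ε * c ≤ ε * (|c| + 1) := by
    gcongr
    linarith [le_abs_self c]
  linarith

/-- Young's inequality `p Re τ(r^(p-1) u* a) ≤ (p - 1) τ(r^p) + τ(|a|^p)` for `r ≥ 0`, a contraction
`u`, and arbitrary `a`. Writing `a = k l` with `k` and `l` behaving like square roots of `|a|`, the
Cauchy–Schwarz inequality reduces it to Young's inequality for the pairs of positive elements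
`r, (u* k) (u* k)*` and `r, l²`. -/
lemma IsTracial.young {τ : A →ₚ[ℂ] ℂ} (hτ : τ.IsTracial) {p : ℝ} (hp : 1 ≤ p) {r : A} (hr : 0 ≤ r)
    {u : A} (hu : ‖u‖ ≤ 1) (a : A) :
    p * (τ (r ^ (p - 1) * (star u * a))).re ≤
      (p - 1) * (τ (r ^ p)).re + (τ (CFC.abs a ^ p)).re := by
  refine le_of_forall_pos_le_add_mul (c := (τ ((CFC.abs a + 1) ^ p)).re / 2) fun ε hε hε1 => ?_
  obtain ⟨k, l, hkl, hl, hk, hll⟩ := CFC.exists_eq_mul_of_abs a hε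
  set k' := star u * k
  set t := CFC.sqrt (r ^ (p - 1))
  have ht : star t = t := (IsSelfAdjoint.of_nonneg (CFC.sqrt_nonneg _)).star_eq
  have htt : t * t = r ^ (p - 1) := CFC.sqrt_mul_sqrt_self _ CFC.rpow_nonneg
  have h1 : τ (r ^ (p - 1) * (star u * a)) = τ ((t * k') * (l * t)) := by
    rw [hτ (t * k'), ← htt, hkl]
    rw [show l * t * (t * k') = l * (t * t * k') by simp only [mul_assoc], hτ l]
    simp only [k', mul_assoc]
  have h2 := τ.two_mul_re_mul_le (t * k') (l * t)
  have h3 : τ ((t * k') * star (t * k')) = τ (r ^ (p - 1) * (k' * star k')) := by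
    rw [star_mul, ht, ← mul_assoc, hτ, ← htt]
    simp only [mul_assoc]
  have h4 : τ (star (l * t) * (l * t)) = τ (r ^ (p - 1) * (l * l)) := by
    rw [star_mul, ht, hl.star_eq, hτ, ← htt,
      show l * t * (t * l) = l * (t * t * l) by simp only [mul_assoc], hτ l]
    simp only [mul_assoc]
  rw [← h1, h3, h4] at h2
  have h5 := hτ.young_of_nonneg hp hr (mul_star_self_nonneg k')
  have h6 : 0 ≤ l * l := by
    have := star_mul_self_nonneg l
    rwa [hl.star_eq] at this
  have h7 := hτ.young_of_nonneg hp hr h6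
  have h8 : star k' * k' ≤ CFC.abs a := by
    refine le_trans ?_ hk
    have h : u * star u ≤ 1 := by
      refine CStarAlgebra.mul_star_le_algebraMap_norm_sq.trans ?_
      rw [← map_one (algebraMap ℝ A)]
      exact algebraMap_mono A (pow_le_one₀ (norm_nonneg u) hu)
    have := star_left_conjugate_le_conjugate h k
    simpa only [k', star_mul, star_star, mul_assoc, mul_one, one_mul] using this
  have h9 := hτ.re_rpow_mono hp (star_mul_self_nonneg k') h8
  rw [← hτ.mul_star_self_rpow hp] at h9
  have h10 := τ.re_mono (CFC.add_smul_one_rpow_le (CFC.abs_nonneg a) hp hε hε1)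
  rw [← hll, map_add, Complex.add_re, re_smul] at h10
  nlinarith

/-- Convexity of `a ↦ τ(|a|^p)`: for `c = s a + t b` the pairing of `|c|^(p-1) u*` with `c`, where
`u` is an approximate polar part of `c`, is nearly `τ(|c|^p)`; its pairings with `a` and `b` are
bounded by Young's inequality. -/
lemma IsTracial.re_abs_rpow_convex {τ : A →ₚ[ℂ] ℂ} (hτ : τ.IsTracial) {p : ℝ} (hp : 1 ≤ p) (a b : A)
    {s t : ℝ} (hs : 0 ≤ s) (ht : 0 ≤ t) (hst : s + t = 1) :
    (τ (CFC.abs (s • a + t • b) ^ p)).re ≤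
      s * (τ (CFC.abs a ^ p)).re + t * (τ (CFC.abs b ^ p)).re := by
  set c := s • a + t • b
  set r := CFC.abs c
  have hr : 0 ≤ r := CFC.abs_nonneg c
  refine le_of_forall_pos_le_add_mul (c := p * (τ (r ^ (p - 1))).re) fun ε hε _ => ?_
  obtain ⟨u, hu, huc⟩ := CFC.exists_abs_sub_le_star_mul c hε
  have h1 := hτ.re_mul_nonneg (CFC.rpow_nonneg (a := r) (y := p - 1)) (sub_nonneg.2 huc)
  have h2 : r ^ (p - 1) * (star u * c - (r - ε • (1 : A))) =
      s • (r ^ (p - 1) * (star u * a)) + t • (r ^ (p - 1) * (star u * b)) - r ^ p +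
        ε • r ^ (p - 1) := by
    rw [← CFC.rpow_sub_one_mul_self hr hp]
    simp only [c, mul_add, mul_sub, mul_smul_comm, mul_one]
    abel
  rw [h2] at h1
  simp only [map_add, map_sub, Complex.add_re, Complex.sub_re, re_smul] at h1
  have h3 := mul_le_mul_of_nonneg_left (hτ.young hp hr hu a) hs
  have h4 := mul_le_mul_of_nonneg_left (hτ.young hp hr hu b) ht
  have h5 : t = 1 - s := by linarith
  have h6 := mul_le_mul_of_nonneg_left h1 (zero_le_one.trans hp)
  subst h5
  nlinarith

/-- Minkowski's inequality: the unit ball of `a ↦ τ(|a|^p)^(1/p)` is convex, and this function is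
homogeneous. -/
theorem IsTracial.minkowski {τ : A →ₚ[ℂ] ℂ} (hτ : τ.IsTracial) {p : ℝ} (hp : 1 ≤ p) (a b : A) :
    (τ (CFC.abs (a + b) ^ p)).re ^ (1 / p) ≤
      (τ (CFC.abs a ^ p)).re ^ (1 / p) + (τ (CFC.abs b ^ p)).re ^ (1 / p) := by
  have hp0 : 0 < p := by linarith
  have hnn : ∀ x : A, 0 ≤ (τ (CFC.abs x ^ p)).re := fun x => τ.re_nonneg CFC.rpow_nonneg
  -- rescaling to the unit ball requires radii which are not zero
  have key : ∀ α β : ℝ, 0 < α → 0 < β → (τ (CFC.abs a ^ p)).re ^ (1 / p) ≤ α →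
      (τ (CFC.abs b ^ p)).re ^ (1 / p) ≤ β → (τ (CFC.abs (a + b) ^ p)).re ^ (1 / p) ≤ α + β := by
    intro α β hα hβ ha hb
    have hsc : ∀ (x : A) (γ : ℝ), 0 ≤ γ →
        (τ (CFC.abs (γ • x) ^ p)).re = γ ^ p * (τ (CFC.abs x ^ p)).re := by
      intro x γ hγ
      have := τ.re_abs_smul_rpow hp0.le (γ : ℂ) x
      rwa [Complex.coe_smul, Complex.norm_of_nonneg hγ] at this
    have hball : ∀ (x : A) (γ : ℝ), 0 < γ → (τ (CFC.abs x ^ p)).re ^ (1 / p) ≤ γ →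
        (τ (CFC.abs (γ⁻¹ • x) ^ p)).re ≤ 1 := by
      intro x γ hγ hx
      rw [one_div, Real.rpow_inv_le_iff_of_pos (hnn x) hγ.le hp0] at hx
      rw [hsc _ _ (by positivity), Real.inv_rpow hγ.le]
      exact inv_mul_le_one_of_le₀ hx (by positivity)
    have h := hτ.re_abs_rpow_convex hp (α⁻¹ • a) (β⁻¹ • b) (s := α / (α + β)) (t := β / (α + β))
      (by positivity) (by positivity) (by field_simp)
    have h1 : (α / (α + β)) • α⁻¹ • a + (β / (α + β)) • β⁻¹ • b = (α + β)⁻¹ • (a + b) := by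
      rw [smul_smul, smul_smul, smul_add]
      congr 2 <;> field_simp
    rw [h1, hsc _ _ (by positivity), Real.inv_rpow (by positivity)] at h
    have h2 : α / (α + β) * (τ (CFC.abs (α⁻¹ • a) ^ p)).re +
        β / (α + β) * (τ (CFC.abs (β⁻¹ • b) ^ p)).re ≤ α / (α + β) * 1 + β / (α + β) * 1 := by
      gcongr
      · exact hball a α hα ha
      · exact hball b β hβ hb
    have h3 : α / (α + β) * 1 + β / (α + β) * 1 = 1 := by field_simp
    rw [one_div, Real.rpow_inv_le_iff_of_pos (hnn _) (by positivity) hp0]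
    have h4 := h.trans (h2.trans_eq h3)
    rwa [inv_mul_le_iff₀ (by positivity), mul_one] at h4
  refine le_of_forall_pos_le_add fun ε hε => ?_
  have h1 : ∀ x : A, 0 ≤ (τ (CFC.abs x ^ p)).re ^ (1 / p) := fun x => Real.rpow_nonneg (hnn x) _
  have := key _ _ (add_pos_of_nonneg_of_pos (h1 a) (half_pos hε))
    (add_pos_of_nonneg_of_pos (h1 b) (half_pos hε)) (by linarith) (by linarith)
  linarith

end PositiveLinearMap

/-! ### Extension of the operations of a *-algebra to a completion -/

namespace QuasiStarAlgebra

variable {X : Type u} {A : Type v} [NormedAddCommGroup X] [NormedSpace ℂ X] [CompleteSpace X]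
  [NonUnitalNormedRing A] [NormedSpace ℂ A] [IsScalarTower ℂ A A] [SMulCommClass ℂ A A]
  [StarRing A] [StarModule ℂ A]

/-- A dense linear embedding of a *-algebra `A` into a Banach space `X`, such that left
multiplications and the involution of `A` are bounded for the norm of `X`, makes `X` a quasi
*-algebra: the operations of `A` are extended by continuity, the right multiplication by `a` as
`x ↦ (a* x*)*`. -/
noncomputable def ofDenseRange (i : A →ₗ[ℂ] X) (hinj : Function.Injective i) (hd : DenseRange i)
    (hmul : ∀ a b, ‖i (a * b)‖ ≤ ‖a‖ * ‖i b‖) (hstar : ∀ a, ‖i (star a)‖ = ‖i a‖) :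
    QuasiStarAlgebra X A :=
  let l : A → X →L[ℂ] X := fun a => (i ∘ₗ LinearMap.mulLeft ℂ a).extendOfNorm i
  let s : X →SL[starRingEnd ℂ] X :=
    (i.comp (starLinearEquiv ℂ : A ≃ₗ⋆[ℂ] A).toLinearMap).extendOfNorm i
  have hl : ∀ a b, l a (i b) = i (a * b) := fun a b =>
    LinearMap.extendOfNorm_eq hd ⟨‖a‖, hmul a⟩ b
  have hs : ∀ a, s (i a) = i (star a) := fun a =>
    LinearMap.extendOfNorm_eq hd ⟨1, fun b => by simp [hstar]⟩ a
  have hss : ∀ x, s (s x) = x := fun x => hd.induction_on x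
    (isClosed_eq (by fun_prop) continuous_id) fun a => by simp [hs]
  have hll : ∀ a b x, l a (l b x) = l (a * b) x := fun a b x => hd.induction_on x
    (isClosed_eq (by fun_prop) (by fun_prop)) fun c => by simp [hl, mul_assoc]
  have hlr : ∀ a b x, l a (s (l b (s x))) = s (l b (s (l a x))) := fun a b x =>
    hd.induction_on x (isClosed_eq (by fun_prop) (by fun_prop)) fun c => by
      simp [hl, hs, mul_assoc]
  have hladd : ∀ a b x, l (a + b) x = l a x + l b x := fun a b x => hd.induction_on x
    (isClosed_eq (by fun_prop) (by fun_prop)) fun c => by simp [hl, add_mul]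
  have hlsmul : ∀ (c : ℂ) a x, l (c • a) x = c • l a x := fun c a x => hd.induction_on x
    (isClosed_eq (by fun_prop) (by fun_prop)) fun b => by simp [hl, smul_mul_assoc]
  { incl := i
    incl_injective := hinj
    lmul := LinearMap.mk₂ ℂ (fun a x => l a x) hladd hlsmul (fun a x y => map_add _ x y)
      (fun c a x => map_smul _ c x)
    rmul := LinearMap.mk₂ ℂ (fun a x => s (l (star a) (s x)))
      (fun a b x => by simp only [star_add, hladd, map_add])
      (fun c a x => by simp only [star_smul, hlsmul, map_smulₛₗ]; simp)
      (fun a x y => by simp only [map_add])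
      (fun c a x => by simp only [map_smulₛₗ]; simp)
    invol := s
    lmul_lmul := hll
    rmul_rmul := fun a b x => by
      simp only [LinearMap.mk₂_apply, hss, hll, star_mul]
    lmul_rmul := fun a b x => hlr a (star b) x
    invol_invol := hss
    invol_lmul := fun a x => by
      simp only [LinearMap.mk₂_apply, star_star]
      exact congrArg (fun y => s (l a y)) (hss x).symm
    invol_rmul := fun a x => hss _
    lmul_incl := hl
    rmul_incl := fun a b => by
      simp only [LinearMap.mk₂_apply, hs, hl, star_mul, star_star]
    invol_incl := hs }

lemma isCQStar_ofDenseRange [CompleteSpace A] [CStarRing A] (i : A →ₗ[ℂ] X)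
    (hinj : Function.Injective i) (hd : DenseRange i)
    (hmul : ∀ a b, ‖i (a * b)‖ ≤ ‖a‖ * ‖i b‖) (hstar : ∀ a, ‖i (star a)‖ = ‖i a‖)
    (hle : ∀ a, ‖i a‖ ≤ ‖a‖) : (ofDenseRange i hinj hd hmul hstar).IsCQStar where
  norm_invol x := by
    have hc : Continuous (ofDenseRange i hinj hd hmul hstar).invol :=
      ContinuousLinearMap.continuous _
    refine hd.induction_on x (isClosed_eq (by fun_prop) (by fun_prop)) fun a => ?_
    exact (congrArg norm ((ofDenseRange i hinj hd hmul hstar).invol_incl a)).trans (hstar a)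
  continuous_lmul a := ContinuousLinearMap.continuous _
  continuous_rmul a := by
    have hs : Continuous (ofDenseRange i hinj hd hmul hstar).invol :=
      ContinuousLinearMap.continuous _
    have hl : Continuous ((ofDenseRange i hinj hd hmul hstar).lmul (star a)) :=
      ContinuousLinearMap.continuous _
    exact hs.comp (hl.comp hs)
  dense := hd
  complete := inferInstance
  norm_star_mul_self a := by rw [CStarRing.norm_star_mul_self, sq]
  norm_incl_le := hle
  norm_lmul_le a x := LinearMap.norm_extendOfNorm_apply_le hd ‖a‖ (hmul a) x
  complete_zero := inferInstance

end QuasiStarAlgebra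

/-! ### The norm on a von Neumann algebra -/

namespace VonNeumannAlgebra

variable {H : Type u} [NormedAddCommGroup H] [InnerProductSpace ℂ H] [CompleteSpace H]

lemma isClosed_toStarSubalgebra (M : VonNeumannAlgebra H) :
    IsClosed (M.toStarSubalgebra : Set (H →L[ℂ] H)) := by
  have h : (M.toStarSubalgebra : Set (H →L[ℂ] H)) =
      Set.centralizer (Set.centralizer (M : Set (H →L[ℂ] H))) := M.centralizer_centralizer.symm
  rw [h]
  exact Set.isClosed_centralizer _

attribute [local instance] isClosed_toStarSubalgebra

/-- The order inherited from `B(H)` is the order of `M` as a C*-algebra, because the square root of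
a positive element of `M` belongs to `M`. -/
lemma starOrderedRing_elem (M : VonNeumannAlgebra H) : StarOrderedRing M.Elem := by
  refine StarOrderedRing.of_le_iff fun x y => ⟨fun hxy => ?_, ?_⟩
  · have h0 : 0 ≤ ((y - x : M.Elem) : H →L[ℂ] H) := sub_nonneg.2 hxy
    have hm := M.abs_rpow_mem (1 / 2) (y - x)
    rw [CFC.abs_of_nonneg _ h0, ← CFC.sqrt_eq_rpow] at hm
    refine ⟨⟨_, hm⟩, Subtype.ext ?_⟩
    have hs : star (CFC.sqrt ((y - x : M.Elem) : H →L[ℂ] H)) = CFC.sqrt _ :=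
      (IsSelfAdjoint.of_nonneg (CFC.sqrt_nonneg _)).star_eq
    change (y : H →L[ℂ] H) = x + star (CFC.sqrt ((y - x : M.Elem) : H →L[ℂ] H)) * CFC.sqrt _
    rw [hs, CFC.sqrt_mul_sqrt_self _ h0]
    simp
  · rintro ⟨s, rfl⟩
    change (x : H →L[ℂ] H) ≤ x + star (s : H →L[ℂ] H) * s
    exact le_add_of_nonneg_right (star_mul_self_nonneg _)

attribute [local instance] starOrderedRing_elem

variable {M : VonNeumannAlgebra H}

/-- The functional calculus in `M` agrees with that in `B(H)`. -/
lemma absRpow_eq {p : ℝ} (hp : 0 ≤ p) (X : M.Elem) : M.absRpow p X = CFC.abs X ^ p := by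
  refine Subtype.ext ?_
  have h := StarAlgHomClass.map_cfc (S := ℂ) M.toStarSubalgebra.subtype
    (fun x : ℝ => x ^ (p / 2)) (star X * X)
    (Real.continuous_rpow_const (by linarith)).continuousOn
    (continuous_subtype_val) (.star_mul_self X) (.star_mul_self (X : H →L[ℂ] H))
  rw [CFC.abs_rpow_eq_cfc hp]
  change CFC.abs (X : H →L[ℂ] H) ^ p = _
  rw [CFC.abs_rpow_eq_cfc hp]
  exact h.symm

/-- A normal finite trace as a positive linear functional on the C*-algebra `M`. -/
noncomputable def NormalFiniteTrace.toPositive (φ : M.NormalFiniteTrace) : M.Elem →ₚ[ℂ] ℂ :=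
  .mk₀ φ.toLinearMap φ.nonneg

lemma NormalFiniteTrace.isTracial (φ : M.NormalFiniteTrace) : φ.toPositive.IsTracial :=
  φ.map_mul_comm

section pNorm

variable (φ : M.NormalFiniteTrace) {p : ℝ}

lemma NormalFiniteTrace.pNorm_eq (hp : 0 ≤ p) (X : M.Elem) :
    φ.pNorm p X = (φ.toPositive (CFC.abs X ^ p)).re ^ (1 / p) := by
  rw [← absRpow_eq hp]
  rfl

lemma NormalFiniteTrace.re_abs_rpow_nonneg (p : ℝ) (X : M.Elem) :
    0 ≤ (φ.toPositive (CFC.abs X ^ p)).re :=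
  φ.toPositive.re_nonneg CFC.rpow_nonneg

lemma NormalFiniteTrace.pNorm_nonneg (hp : 0 ≤ p) (X : M.Elem) : 0 ≤ φ.pNorm p X := by
  rw [φ.pNorm_eq hp]
  exact Real.rpow_nonneg (φ.re_abs_rpow_nonneg p X) _

lemma NormalFiniteTrace.pNorm_add_le (hp : 1 ≤ p) (X Y : M.Elem) :
    φ.pNorm p (X + Y) ≤ φ.pNorm p X + φ.pNorm p Y := by
  simp only [φ.pNorm_eq (zero_le_one.trans hp)]
  exact φ.isTracial.minkowski hp X Y

lemma NormalFiniteTrace.pNorm_smul (hp : 1 ≤ p) (c : ℂ) (X : M.Elem) :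
    φ.pNorm p (c • X) = ‖c‖ * φ.pNorm p X := by
  have hp0 : 0 < p := by linarith
  rw [φ.pNorm_eq hp0.le, φ.pNorm_eq hp0.le, φ.toPositive.re_abs_smul_rpow hp0.le,
    Real.mul_rpow (by positivity) (φ.re_abs_rpow_nonneg p X), one_div,
    Real.rpow_rpow_inv (norm_nonneg c) hp0.ne']

lemma NormalFiniteTrace.pNorm_star (hp : 1 ≤ p) (X : M.Elem) :
    φ.pNorm p (star X) = φ.pNorm p X := by
  rw [φ.pNorm_eq (by linarith), φ.pNorm_eq (by linarith), φ.isTracial.abs_star_rpow hp]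

lemma NormalFiniteTrace.pNorm_mul_le (hp : 1 ≤ p) (X Y : M.Elem) :
    φ.pNorm p (X * Y) ≤ ‖X‖ * φ.pNorm p Y := by
  have hp0 : 0 < p := by linarith
  rw [φ.pNorm_eq hp0.le, φ.pNorm_eq hp0.le, ← Real.rpow_rpow_inv (norm_nonneg X) hp0.ne', one_div,
    ← Real.mul_rpow (by positivity) (φ.re_abs_rpow_nonneg p Y)]
  exact Real.rpow_le_rpow (φ.re_abs_rpow_nonneg p _) (φ.isTracial.re_abs_mul_rpow_le hp X Y)
    (by positivity)

lemma NormalFiniteTrace.pNorm_le_norm (hφ : φ.toLinearMap 1 ≤ 1) (hp : 1 ≤ p) (X : M.Elem) :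
    φ.pNorm p X ≤ ‖X‖ := by
  have hp0 : 0 < p := by linarith
  have h1 : (φ.toPositive 1).re ≤ 1 := (Complex.le_def.1 hφ).1
  rw [φ.pNorm_eq hp0.le, one_div, Real.rpow_inv_le_iff_of_pos (φ.re_abs_rpow_nonneg p X)
    (norm_nonneg X) hp0]
  exact (φ.isTracial.re_abs_rpow_le_norm hp X).trans
    (mul_le_of_le_one_right (by positivity) h1)

end pNorm

section supPNorm

variable {I : Type v} {φ : I → M.NormalFiniteTrace} {p : ℝ}

lemma bddAbove_pNorm (hφ : ∀ α, (φ α).toLinearMap 1 ≤ 1) (hp : 1 ≤ p) (X : M.Elem) :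
    BddAbove (Set.range fun α => (φ α).pNorm p X) :=
  ⟨‖X‖, by rintro _ ⟨α, rfl⟩; exact (φ α).pNorm_le_norm (hφ α) hp X⟩

lemma pNorm_le_supPNorm (hφ : ∀ α, (φ α).toLinearMap 1 ≤ 1) (hp : 1 ≤ p) (X : M.Elem) (α : I) :
    (φ α).pNorm p X ≤ supPNorm φ p X :=
  le_ciSup (bddAbove_pNorm hφ hp X) α

lemma supPNorm_nonneg (hp : 0 ≤ p) (X : M.Elem) : 0 ≤ supPNorm φ p X :=
  Real.iSup_nonneg fun α => (φ α).pNorm_nonneg hp X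

lemma supPNorm_smul (hp : 1 ≤ p) (c : ℂ) (X : M.Elem) :
    supPNorm φ p (c • X) = ‖c‖ * supPNorm φ p X := by
  simp only [supPNorm, NormalFiniteTrace.pNorm_smul _ hp,
    Real.mul_iSup_of_nonneg (norm_nonneg c)]

lemma supPNorm_star (hp : 1 ≤ p) (X : M.Elem) : supPNorm φ p (star X) = supPNorm φ p X := by
  simp only [supPNorm, NormalFiniteTrace.pNorm_star _ hp]

lemma supPNorm_le_norm (hφ : ∀ α, (φ α).toLinearMap 1 ≤ 1) (hp : 1 ≤ p) (X : M.Elem) :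
    supPNorm φ p X ≤ ‖X‖ :=
  Real.iSup_le (fun α => (φ α).pNorm_le_norm (hφ α) hp X) (norm_nonneg X)

lemma supPNorm_mul_le (hφ : ∀ α, (φ α).toLinearMap 1 ≤ 1) (hp : 1 ≤ p) (X Y : M.Elem) :
    supPNorm φ p (X * Y) ≤ ‖X‖ * supPNorm φ p Y :=
  Real.iSup_le (fun α => ((φ α).pNorm_mul_le hp X Y).trans
    (mul_le_mul_of_nonneg_left (pNorm_le_supPNorm hφ hp Y α) (norm_nonneg X)))
    (mul_nonneg (norm_nonneg X) (supPNorm_nonneg (by linarith) Y))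

lemma eq_zero_of_supPNorm_eq_zero (hsuff : IsSufficient φ)
    (hφ : ∀ α, (φ α).toLinearMap 1 ≤ 1) (hp : 1 ≤ p) {X : M.Elem} (hX : supPNorm φ p X = 0) :
    X = 0 := by
  have hp0 : 0 < p := by linarith
  have h1 : ∀ α, (φ α).toLinearMap (CFC.abs X ^ p) = 0 := by
    intro α
    have h2 : (φ α).pNorm p X = 0 :=
      le_antisymm ((pNorm_le_supPNorm hφ hp X α).trans_eq hX) ((φ α).pNorm_nonneg hp0.le X)
    rw [(φ α).pNorm_eq hp0.le, Real.rpow_eq_zero ((φ α).re_abs_rpow_nonneg p X)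
      (by positivity)] at h2
    have h3 := Complex.le_def.1 ((φ α).nonneg (CFC.abs X ^ p) (CFC.rpow_nonneg (a := CFC.abs X)))
    exact Complex.ext h2 h3.2.symm
  have h4 : CFC.abs X ^ p = 0 := hsuff _ (CFC.rpow_nonneg (a := CFC.abs X)) h1
  have h5 := CFC.rpow_rpow_of_exponent_nonneg (CFC.abs X) p p⁻¹ hp0.le (by positivity)
    (CFC.abs_nonneg X)
  have h6 : (0 : M.Elem) ^ p⁻¹ = 0 := CFC.zero_rpow (by positivity)
  rw [h4, h6, mul_inv_cancel₀ hp0.ne', CFC.rpow_one _ (CFC.abs_nonneg X)] at h5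
  exact CFC.abs_eq_zero_iff.1 h5.symm

lemma supPNormIsNorm (hsuff : IsSufficient φ) (hφ : ∀ α, (φ α).toLinearMap 1 ≤ 1) (hp : 1 ≤ p) :
    SupPNormIsNorm φ p where
  bddAbove := bddAbove_pNorm hφ hp
  nonneg := supPNorm_nonneg (by linarith)
  smul := supPNorm_smul hp
  add_le X Y := Real.iSup_le (fun α => ((φ α).pNorm_add_le hp X Y).trans
    (add_le_add (pNorm_le_supPNorm hφ hp X α) (pNorm_le_supPNorm hφ hp Y α)))
    (add_nonneg (supPNorm_nonneg (by linarith) X) (supPNorm_nonneg (by linarith) Y))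
  eq_zero_iff X := ⟨eq_zero_of_supPNorm_eq_zero hsuff hφ hp, by
    rintro rfl
    simpa using supPNorm_smul (φ := φ) hp 0 0⟩

end supPNorm

namespace WithPNorm

variable {I : Type v} {φ : I → M.NormalFiniteTrace} {p : ℝ}

/-- The canonical map of `M` into its completion, as a linear map. -/
noncomputable def toCompletionₗ (h : SupPNormIsNorm φ p) : M.Elem →ₗ[ℂ] Completion h :=
  (UniformSpace.Completion.toComplₗᵢ (𝕜 := ℂ) (E := WithPNorm h)).toLinearMap ∘ₗ
    (ofElem h).toLinearMap

lemma norm_toCompletionₗ (h : SupPNormIsNorm φ p) (X : M.Elem) :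
    ‖toCompletionₗ h X‖ = supPNorm φ p X :=
  UniformSpace.Completion.norm_coe (ofElem h X)

lemma toCompletionₗ_injective (h : SupPNormIsNorm φ p) : Function.Injective (toCompletionₗ h) :=
  (UniformSpace.Completion.coe_injective (WithPNorm h)).comp (ofElem h).injective

lemma denseRange_toCompletionₗ (h : SupPNormIsNorm φ p) : DenseRange (toCompletionₗ h) :=
  UniformSpace.Completion.denseRange_coe.comp (ofElem h).surjective.denseRange
    (UniformSpace.Completion.continuous_coe _)

end WithPNorm

end VonNeumannAlgebra

theorem mainTheorem5 {H : Type u} [NormedAddCommGroup H] [InnerProductSpace ℂ H] [CompleteSpace H]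
    (M : VonNeumannAlgebra H) {I : Type v} (φ : I → M.NormalFiniteTrace)
    (hsuff : VonNeumannAlgebra.IsSufficient φ)
    (hP : ∀ α, (φ α).toLinearMap 1 ≤ 1)
    (p : ℝ) (hp : 1 ≤ p) :
    ∃ h : VonNeumannAlgebra.SupPNormIsNorm φ p,
      ∃ Q : QuasiStarAlgebra (VonNeumannAlgebra.WithPNorm.Completion h) M.Elem,
        (∀ X : M.Elem, Q.incl X = VonNeumannAlgebra.WithPNorm.toCompletion h X) ∧
        Q.IsCQStar := by
  have h := VonNeumannAlgebra.supPNormIsNorm hsuff hP hp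
  have hcomplete : CompleteSpace M.Elem := M.isClosed_toStarSubalgebra.completeSpace_coe
  let i := VonNeumannAlgebra.WithPNorm.toCompletionₗ h
  have hi : ∀ X, ‖i X‖ = VonNeumannAlgebra.supPNorm φ p X :=
    VonNeumannAlgebra.WithPNorm.norm_toCompletionₗ h
  have hmul : ∀ X Y : M.Elem, ‖i (X * Y)‖ ≤ ‖X‖ * ‖i Y‖ := fun X Y => by
    rw [hi, hi]
    exact VonNeumannAlgebra.supPNorm_mul_le hP hp X Y
  have hstar : ∀ X : M.Elem, ‖i (star X)‖ = ‖i X‖ := fun X => by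
    rw [hi, hi]
    exact VonNeumannAlgebra.supPNorm_star hp X
  refine ⟨h, .ofDenseRange i (VonNeumannAlgebra.WithPNorm.toCompletionₗ_injective h)
    (VonNeumannAlgebra.WithPNorm.denseRange_toCompletionₗ h) hmul hstar, fun X => rfl,
    QuasiStarAlgebra.isCQStar_ofDenseRange _ _ _ _ _ fun X => ?_⟩
  rw [hi]
  exact VonNeumannAlgebra.supPNorm_le_norm hP hp X
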